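/- Let $\alpha>-1$ and, for $t\ge 0$, let $P_n(x;t,\alpha)$ ($n=0,1,2,\dots$) be the monic polynomials of degree $n$ orthogonal on $(0,\infty)$ with respect to the weight $w(x;t,\alpha)=x^{\alpha}e^{-x-t/x}$, with $h_n(t)=\int_0^\infty P_n(x;t,\alpha)^2\,w(x;t,\alpha)\,dx$. Let $\alpha_n(t),\beta_n(t)$ be the coefficients of the three-term recurrence relation $$xP_n(x;t,\alpha)=P_{n+1}(x;t,\alpha)+\alpha_n(t)P_n(x;t,\alpha)+\beta_n(t)P_{n-1}(x;t,\alpha),\qquad \beta_0(t)=0,$$ that is, $\alpha_n(t)=\frac1{h_n(t)}\int_0^\infty xP_n(x;t,\alpha)^2\,w(x;t,\alpha)\,dx$ and, for $n\ge1$, $\beta_n(t)=\frac1{h_{n-1}(t)}\int_0^\infty xP_n(x;t,\alpha)P_{n-1}(x;t,\alpha)\,w(x;t,\alpha)\,dx$. Then, for each fixed $\alpha>-1$ and each fixed integer $n\ge 0$, as $t\to+\infty$, $$\alpha_n(t)=\sqrt t+\frac{2\alpha+3(2n+1)}{4}+\frac{(2\alpha+2n+1)(2\alpha+6n+3)}{32\sqrt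 t}-\frac{(2\alpha+2n+1)\left[\alpha(4n+2)+8n^2+8n+3\right]}{64\,t}+O(t^{-3/2}),$$ $$\beta_n(t)=\frac{n\sqrt t}{2}+\frac{2\alpha n+3n^2}{4}+\frac{3n(2\alpha+2n+1)(2\alpha+2n-1)}{64\sqrt t}-\frac{n^2(2\alpha+2n+1)(2\alpha+2n-1)}{32\,t}+O(t^{-3/2}).$$ -/

import Mathlib

open Polynomial MeasureTheory Set Filter Asymptotics

noncomputable section

namespace SingularLaguerre

/-- The singularly perturbed Laguerre weight `x ^ α * exp (-x - t / x)` (used on `(0, ∞)`). -/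
def weight (α t x : ℝ) : ℝ := x ^ α * Real.exp (-x - t / x)

/-- The bilinear form `∫₀^∞ p(x) q(x) w(x; t, α) dx` on real polynomials. -/
def inn (α t : ℝ) (p q : ℝ[X]) : ℝ :=
  ∫ x in Ioi (0 : ℝ), p.eval x * q.eval x * weight α t x

/-- The monic orthogonal polynomials `P_n(x; t, α)`, obtained from `1, x, x², …` by the
Gram–Schmidt process. Lemmas `orthoPoly_monic`, `natDegree_orthoPoly`, `inn_orthoPoly`,
`inn_orthoPoly_self_pos` below show that they are monic of degree `n` and orthogonal. -/
def orthoPoly (α t : ℝ) (n : ℕ) : ℝ[X] :=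
  X ^ n - ∑ j : Fin n,
    C (inn α t (X ^ n) (orthoPoly α t j) / inn α t (orthoPoly α t j) (orthoPoly α t j)) *
      orthoPoly α t j
termination_by n
decreasing_by all_goals exact j.2

/-- `h_n(t, α) = ∫₀^∞ P_n(x)² w(x; t, α) dx`. -/
def normConst (α t : ℝ) (n : ℕ) : ℝ := inn α t (orthoPoly α t n) (orthoPoly α t n)

/-- The diagonal recurrence coefficient
`α_n(t, α) = h_n⁻¹ ∫₀^∞ x P_n(x)² w(x; t, α) dx`. -/
def recA (α t : ℝ) (n : ℕ) : ℝ :=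
  inn α t (X * orthoPoly α t n) (orthoPoly α t n) / normConst α t n

/-- The off-diagonal recurrence coefficient `β_0 = 0`,
`β_n(t, α) = h_{n-1}⁻¹ ∫₀^∞ x P_n(x) P_{n-1}(x) w(x; t, α) dx` for `n ≥ 1`. -/
def recB (α t : ℝ) : ℕ → ℝ
  | 0 => 0
  | n + 1 => inn α t (X * orthoPoly α t (n + 1)) (orthoPoly α t n) / normConst α t n

/-! The next lemmas show that these are the objects they are meant to be, in particular that
the polynomials satisfy the three-term recurrence with coefficients `recA` and `recB`. -/

lemma weight_pos (α t : ℝ) {x : ℝ} (hx : 0 < x) : 0 < weight α t x :=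
  mul_pos (Real.rpow_pos_of_pos hx _) (Real.exp_pos _)

lemma integrableOn_eval_mul_weight {α t : ℝ} (hα : -1 < α) (ht : 0 ≤ t) (p : ℝ[X]) :
    IntegrableOn (fun x => p.eval x * weight α t x) (Ioi 0) := by
  induction p using Polynomial.induction_on' with
  | add p q hp hq =>
    refine (hp.add hq).congr (Eventually.of_forall fun x => ?_)
    simp [add_mul]
  | monomial n a =>
    have hG := (Real.GammaIntegral_convergent (s := α + n + 1)
      (by have : (0 : ℝ) ≤ n := n.cast_nonneg
          linarith)).const_mul |a|
    refine Integrable.mono' hG ?_ ?_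
    · have : Measurable (fun x => (monomial n a).eval x * weight α t x) := by
        unfold weight
        have := (monomial n a).continuous.measurable
        fun_prop
      exact this.aestronglyMeasurable
    · filter_upwards [ae_restrict_mem measurableSet_Ioi] with x hx
      have hx0 : 0 < x := hx
      rw [eval_monomial, norm_mul, norm_mul, Real.norm_eq_abs, Real.norm_eq_abs,
        Real.norm_of_nonneg (weight_pos α t hx0).le, mul_assoc,
        abs_of_pos (pow_pos hx0 n)]
      refine mul_le_mul_of_nonneg_left ?_ (abs_nonneg a)
      have h1 : x ^ (α + n + 1 - 1) = x ^ n * x ^ α := by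
        rw [add_sub_cancel_right, Real.rpow_add hx0, Real.rpow_natCast, mul_comm]
      have h2 : Real.exp (-x - t / x) ≤ Real.exp (-x) :=
        Real.exp_le_exp.2 (by have := div_nonneg ht hx0.le; linarith)
      rw [h1, weight, ← mul_assoc, mul_comm (Real.exp (-x))]
      exact mul_le_mul_of_nonneg_left h2 (by positivity)

lemma integrable_inn {α t : ℝ} (hα : -1 < α) (ht : 0 ≤ t) (p q : ℝ[X]) :
    IntegrableOn (fun x => p.eval x * q.eval x * weight α t x) (Ioi 0) := by
  simpa using integrableOn_eval_mul_weight hα ht (p * q)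

lemma inn_comm (α t : ℝ) (p q : ℝ[X]) : inn α t p q = inn α t q p := by
  simp only [inn, mul_comm (p.eval _)]

lemma inn_X_mul (α t : ℝ) (p q : ℝ[X]) : inn α t (X * p) q = inn α t p (X * q) := by
  simp only [inn, eval_mul, eval_X]
  congr 1
  ext x
  ring

lemma inn_C_mul (α t c : ℝ) (p q : ℝ[X]) : inn α t (C c * p) q = c * inn α t p q := by
  simp only [inn, eval_mul, eval_C, mul_assoc, integral_const_mul]

lemma inn_add {α t : ℝ} (hα : -1 < α) (ht : 0 ≤ t) (p q r : ℝ[X]) :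
    inn α t (p + q) r = inn α t p r + inn α t q r := by
  simp only [inn]
  rw [← integral_add (integrable_inn hα ht p r) (integrable_inn hα ht q r)]
  simp [add_mul]

lemma inn_sub {α t : ℝ} (hα : -1 < α) (ht : 0 ≤ t) (p q r : ℝ[X]) :
    inn α t (p - q) r = inn α t p r - inn α t q r := by
  simp only [inn]
  rw [← integral_sub (integrable_inn hα ht p r) (integrable_inn hα ht q r)]
  simp [sub_mul]

lemma inn_sum {α t : ℝ} (hα : -1 < α) (ht : 0 ≤ t) {ι : Type*} (s : Finset ι) (f : ι → ℝ[X])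
    (r : ℝ[X]) : inn α t (∑ i ∈ s, f i) r = ∑ i ∈ s, inn α t (f i) r := by
  classical
  induction s using Finset.induction_on with
  | empty => simp [inn]
  | insert a s ha ih => rw [Finset.sum_insert ha, Finset.sum_insert ha, inn_add hα ht, ih]

lemma inn_self_pos {α t : ℝ} (hα : -1 < α) (ht : 0 ≤ t) {p : ℝ[X]} (hp : p ≠ 0) :
    0 < inn α t p p := by
  unfold inn
  rw [setIntegral_pos_iff_support_of_nonneg_ae _ (integrable_inn hα ht p p)]
  · have hsub : Ioi (0 : ℝ) \ (p.roots.toFinset : Set ℝ) ⊆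
        Function.support (fun x => p.eval x * p.eval x * weight α t x) ∩ Ioi 0 := by
      rintro x ⟨hx, hr⟩
      refine ⟨?_, hx⟩
      have : p.eval x ≠ 0 := by
        intro h
        exact hr (by simpa [hp] using h)
      exact mul_ne_zero (mul_ne_zero this this) (weight_pos α t hx).ne'
    refine lt_of_lt_of_le ?_ (measure_mono hsub)
    rw [measure_sdiff_null (p.roots.toFinset.finite_toSet.measure_zero volume)]
    simp
  · filter_upwards [ae_restrict_mem measurableSet_Ioi] with x hx
    exact mul_nonneg (mul_self_nonneg _) (weight_pos α t hx).le

lemma orthoPoly_monic_natDegree (α t : ℝ) (n : ℕ) :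
    (orthoPoly α t n).Monic ∧ (orthoPoly α t n).natDegree = n := by
  induction n using Nat.strong_induction_on with
  | _ n ih =>
    have hlt : (∑ j : Fin n, C (inn α t (X ^ n) (orthoPoly α t j) /
        inn α t (orthoPoly α t j) (orthoPoly α t j)) * orthoPoly α t j).degree
          < (n : WithBot ℕ) := by
      refine (degree_sum_le _ _).trans_lt ((Finset.sup_lt_iff (WithBot.bot_lt_coe n)).2 ?_)
      intro j _
      rw [← smul_eq_C_mul]
      refine (degree_smul_le _ _).trans_lt ?_
      rw [degree_eq_natDegree (ih j j.2).1.ne_zero, (ih j j.2).2]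
      exact WithBot.coe_lt_coe.2 j.2
    rw [orthoPoly]
    refine ⟨(monic_X_pow n).sub_of_left (by simpa using hlt), ?_⟩
    apply natDegree_eq_of_degree_eq_some
    rw [degree_sub_eq_left_of_degree_lt (by simpa using hlt), degree_X_pow]

lemma orthoPoly_monic (α t : ℝ) (n : ℕ) : (orthoPoly α t n).Monic :=
  (orthoPoly_monic_natDegree α t n).1

lemma natDegree_orthoPoly (α t : ℝ) (n : ℕ) : (orthoPoly α t n).natDegree = n :=
  (orthoPoly_monic_natDegree α t n).2

lemma inn_orthoPoly_self_pos {α t : ℝ} (hα : -1 < α) (ht : 0 ≤ t) (n : ℕ) :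
    0 < normConst α t n :=
  inn_self_pos hα ht (orthoPoly_monic α t n).ne_zero

lemma inn_orthoPoly_of_lt {α t : ℝ} (hα : -1 < α) (ht : 0 ≤ t) (n : ℕ) :
    ∀ k < n, inn α t (orthoPoly α t n) (orthoPoly α t k) = 0 := by
  induction n using Nat.strong_induction_on with
  | _ n ih =>
    intro k hk
    rw [orthoPoly, inn_sub hα ht, inn_sum hα ht, Finset.sum_eq_single (⟨k, hk⟩ : Fin n)]
    · have hk0 : inn α t (orthoPoly α t k) (orthoPoly α t k) ≠ 0 :=
        (inn_orthoPoly_self_pos hα ht k).ne'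
      rw [inn_C_mul, div_mul_cancel₀ _ hk0, sub_self]
    · intro j _ hj
      rw [inn_C_mul]
      rcases lt_or_gt_of_ne (fun h => hj (Fin.ext h) : (j : ℕ) ≠ k) with h | h
      · rw [inn_comm α t (orthoPoly α t j) (orthoPoly α t k), ih k hk j h, mul_zero]
      · rw [ih j j.2 k h, mul_zero]
    · simp

lemma inn_orthoPoly {α t : ℝ} (hα : -1 < α) (ht : 0 ≤ t) (j k : ℕ) :
    inn α t (orthoPoly α t j) (orthoPoly α t k) = if j = k then normConst α t j else 0 := by
  rcases lt_trichotomy j k with h | rfl | h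
  · rw [inn_comm, inn_orthoPoly_of_lt hα ht k j h, if_neg h.ne]
  · simp [normConst]
  · rw [inn_orthoPoly_of_lt hα ht j k h, if_neg h.ne']

/-- `P_0, …, P_{n-1}` span the polynomials of degree `< n`. -/
lemma inn_eq_zero_of_degree_lt {α t : ℝ} (hα : -1 < α) (ht : 0 ≤ t) (n : ℕ) (q : ℝ[X])
    (h : ∀ k < n, inn α t q (orthoPoly α t k) = 0) (r : ℝ[X]) (hr : r.degree < n) :
    inn α t q r = 0 := by
  induction n generalizing r with
  | zero =>
    have : r = 0 := by simpa using hr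
    simp [this, inn]
  | succ m ih =>
    have hr' : (r - C (r.coeff m) * orthoPoly α t m).degree < m := by
      rw [degree_lt_iff_coeff_zero]
      intro i hi
      rcases hi.eq_or_lt with rfl | hi
      · have := (orthoPoly_monic α t m).coeff_natDegree
        rw [natDegree_orthoPoly] at this
        simp [this]
      · rw [coeff_sub, coeff_C_mul, coeff_eq_zero_of_natDegree_lt (p := orthoPoly α t m)
          (by rwa [natDegree_orthoPoly]), (degree_lt_iff_coeff_zero _ _).1 hr i hi]
        simp
    have h1 := ih (fun k hk => h k (by omega)) _ hr'
    rw [inn_comm, inn_sub hα ht, inn_C_mul, inn_comm α t (orthoPoly α t m), h m (by omega)] at h1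
    rw [inn_comm]
    simpa using h1

lemma eq_zero_of_inn_eq_zero {α t : ℝ} (hα : -1 < α) (ht : 0 ≤ t) (n : ℕ) (q : ℝ[X])
    (hq : q.degree < n) (h : ∀ k < n, inn α t q (orthoPoly α t k) = 0) : q = 0 := by
  by_contra hne
  exact (inn_self_pos hα ht hne).ne' (inn_eq_zero_of_degree_lt hα ht n q h q hq)

lemma inn_orthoPoly_of_degree_lt {α t : ℝ} (hα : -1 < α) (ht : 0 ≤ t) (n : ℕ) (q : ℝ[X])
    (hq : q.degree < n) : inn α t (orthoPoly α t n) q = 0 :=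
  inn_eq_zero_of_degree_lt hα ht n _ (inn_orthoPoly_of_lt hα ht n) q hq

/-- The polynomials are the only monic orthogonal polynomials for the weight. -/
lemma eq_orthoPoly {α t : ℝ} (hα : -1 < α) (ht : 0 ≤ t) (n : ℕ) (p : ℝ[X]) (hp : p.Monic)
    (hd : p.natDegree = n) (h : ∀ q : ℝ[X], q.degree < n → inn α t p q = 0) :
    p = orthoPoly α t n := by
  refine sub_eq_zero.1 (eq_zero_of_inn_eq_zero hα ht n _ ?_ fun k hk => ?_)
  · rw [degree_lt_iff_coeff_zero]
    intro i hi
    rcases hi.eq_or_lt with rfl | hi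
    · have h1 := (orthoPoly_monic α t n).coeff_natDegree
      have h2 := hp.coeff_natDegree
      rw [natDegree_orthoPoly] at h1
      rw [hd] at h2
      simp [h1, h2]
    · rw [coeff_sub, coeff_eq_zero_of_natDegree_lt (by rwa [hd]),
        coeff_eq_zero_of_natDegree_lt (by rwa [natDegree_orthoPoly]), sub_zero]
  · rw [inn_sub hα ht, inn_orthoPoly_of_lt hα ht n k hk, h, sub_zero]
    rw [degree_eq_natDegree (orthoPoly_monic α t k).ne_zero, natDegree_orthoPoly]
    exact_mod_cast hk

lemma degree_orthoPoly (α t : ℝ) (n : ℕ) : (orthoPoly α t n).degree = n := by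
  rw [degree_eq_natDegree (orthoPoly_monic α t n).ne_zero, natDegree_orthoPoly]

/-- The remainder of the three-term recurrence for `n`, before the term with `P_{n-1}`. -/
lemma degree_recurrence_aux (α t c : ℝ) (n : ℕ) (r : ℝ[X]) (hr : r.degree < ((n + 1 : ℕ) : WithBot ℕ)) :
    (X * orthoPoly α t n - (orthoPoly α t (n + 1) + C c * orthoPoly α t n + r)).degree
      < ((n + 1 : ℕ) : WithBot ℕ) := by
  rw [degree_lt_iff_coeff_zero] at hr ⊢
  have hc : ∀ m, (orthoPoly α t m).coeff m = 1 := fun m => by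
    have := (orthoPoly_monic α t m).coeff_natDegree
    rwa [natDegree_orthoPoly] at this
  have hz : ∀ m i, m < i → (orthoPoly α t m).coeff i = 0 := fun m i hi =>
    coeff_eq_zero_of_natDegree_lt (by rwa [natDegree_orthoPoly])
  intro i hi
  obtain ⟨i, rfl⟩ : ∃ j, i = j + 1 := ⟨i - 1, by omega⟩
  rw [coeff_sub, coeff_add, coeff_add, coeff_X_mul, coeff_C_mul, hr _ hi,
    hz n (i + 1) (by omega)]
  rcases hi.eq_or_lt with h | h
  · obtain rfl : n = i := by omega
    simp [hc]
  · rw [hz n i (by omega), hz (n + 1) (i + 1) h]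
    simp

/-- `x P_0 = P_1 + α_0 P_0`. -/
lemma three_term_zero {α t : ℝ} (hα : -1 < α) (ht : 0 ≤ t) :
    X * orthoPoly α t 0 = orthoPoly α t 1 + C (recA α t 0) * orthoPoly α t 0 := by
  have hd := degree_recurrence_aux α t (recA α t 0) 0 0 (by simp)
  rw [add_zero] at hd
  refine sub_eq_zero.1 (eq_zero_of_inn_eq_zero hα ht 1 _ hd fun k hk => ?_)
  obtain rfl : k = 0 := by omega
  rw [inn_sub hα ht, inn_add hα ht, inn_C_mul, inn_orthoPoly_of_lt hα ht 1 0 hk, recA,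
    inn_orthoPoly hα ht, if_pos rfl, div_mul_cancel₀ _ (inn_orthoPoly_self_pos hα ht 0).ne']
  ring

/-- `x P_n = P_{n+1} + α_n P_n + β_n P_{n-1}` for `n ≥ 1`. -/
lemma three_term_succ {α t : ℝ} (hα : -1 < α) (ht : 0 ≤ t) (n : ℕ) :
    X * orthoPoly α t (n + 1) = orthoPoly α t (n + 2) +
      C (recA α t (n + 1)) * orthoPoly α t (n + 1) + C (recB α t (n + 1)) * orthoPoly α t n := by
  have hd := degree_recurrence_aux α t (recA α t (n + 1)) (n + 1)
    (C (recB α t (n + 1)) * orthoPoly α t n) (by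
      rw [← smul_eq_C_mul]
      refine (degree_smul_le _ _).trans_lt ?_
      rw [degree_orthoPoly]
      exact_mod_cast (by omega : n < n + 1 + 1))
  refine sub_eq_zero.1 (eq_zero_of_inn_eq_zero hα ht (n + 2) _ hd fun k hk => ?_)
  rw [inn_sub hα ht, inn_add hα ht, inn_add hα ht, inn_C_mul, inn_C_mul,
    inn_orthoPoly_of_lt hα ht (n + 2) k hk, inn_orthoPoly hα ht (n + 1), inn_orthoPoly hα ht n]
  rcases (by omega : k = n + 1 ∨ k = n ∨ k < n) with rfl | rfl | hkn
  · rw [if_pos rfl, if_neg (by omega), recA,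
      div_mul_cancel₀ _ (inn_orthoPoly_self_pos hα ht _).ne']
    ring
  · rw [if_pos rfl, if_neg (by omega), recB,
      div_mul_cancel₀ _ (inn_orthoPoly_self_pos hα ht _).ne']
    ring
  · rw [if_neg (by omega), if_neg (by omega), inn_X_mul,
      inn_orthoPoly_of_degree_lt hα ht (n + 1) _ (by
        rw [degree_mul, degree_X, degree_orthoPoly]
        exact_mod_cast (by omega : 1 + k < n + 1))]
    ring

end SingularLaguerre

end

noncomputable section

namespace SingularLaguerre

/-! ### The functional with weight w/x, and integration by parts. -/

section

/-! Let L(p) = ∫ p w/x, a_n = α_n - (2n+1+α) and b_n = t L(P_n P_{n-1})/h_{n-1}, with b_0 = 0.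
Integration by parts gives a_n = t L(P_n²)/h_n > 0. Combined with the three-term recurrence and
division by x under L, it yields three algebraic relations between a_n, β_n and b_n
(`exists_laguerreFreud`).

With s = t^(-1/2), the multiples A = s a, D = s β, B = s b satisfy a system depending regularly on s
(`exists_isScaledSystem`). Positivity of A and D forces B_{n+1} < 0 and bounds each B_n uniformly
for 0 < s ≤ 1 (`exists_bound_scaledSystem`); no asymptotics of integrals are needed.

The explicit cubics `expA`, `expD`, `expB` solve the system up to O(s⁴). In the equations for A and
D, B occurs only with a factor s, so an error O(s^k) in all B_n gives errors O(s^(k+1)) in A and D,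
and then in B. Starting from boundedness (k = 0), this reaches O(s⁴) for A and D
(`isBigO_scaledSystem`). Multiplying by √t turns s⁴ into t^(-3/2). -/

/-- Half of the decay of e^(-t/x) absorbs the extra 1/x, through u ≤ e^u with u = t/(2x). This makes
L converge although α - 1 may lie below -1. -/
lemma weight_sub_one_le (α : ℝ) {t x : ℝ} (ht : 0 < t) (hx : 0 < x) :
    weight (α - 1) t x ≤ 2 / t * weight α (t / 2) x := by
  have h1 : t / 2 / x ≤ Real.exp (t / 2 / x) := by
    have := Real.add_one_le_exp (t / 2 / x)
    linarith
  have h2 : Real.exp (-x - t / 2 / x) = Real.exp (-x - t / x) * Real.exp (t / 2 / x) := by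
    rw [← Real.exp_add]
    ring_nf
  have h3 : weight (α - 1) t x = 2 / t * (x ^ α * (Real.exp (-x - t / x) * (t / 2 / x))) := by
    rw [weight, Real.rpow_sub_one hx.ne']
    field_simp
  rw [h3, weight, h2]
  gcongr

lemma integrableOn_eval_mul_weight_sub_one {α t : ℝ} (hα : -1 < α) (ht : 0 < t) (p : ℝ[X]) :
    IntegrableOn (fun x => p.eval x * weight (α - 1) t x) (Ioi 0) := by
  refine Integrable.mono'
    ((integrableOn_eval_mul_weight hα (half_pos ht).le p).norm.const_mul (2 / t)) ?_ ?_
  · have : Measurable (fun x => p.eval x * weight (α - 1) t x) := by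
      unfold weight
      have := p.continuous.measurable
      fun_prop
    exact this.aestronglyMeasurable
  · filter_upwards [ae_restrict_mem measurableSet_Ioi] with x hx
    rw [norm_mul, norm_mul, Real.norm_of_nonneg (weight_pos _ _ hx).le,
      Real.norm_of_nonneg (weight_pos _ _ hx).le, mul_left_comm]
    exact mul_le_mul_of_nonneg_left (weight_sub_one_le α ht hx) (norm_nonneg _)

/-- The linear functional `p ↦ ∫₀^∞ p(x) x⁻¹ w(x; t, α) dx` on real polynomials. -/
def invMoment {α t : ℝ} (hα : -1 < α) (ht : 0 < t) : ℝ[X] →ₗ[ℝ] ℝ where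
  toFun p := ∫ x in Ioi (0 : ℝ), p.eval x * weight (α - 1) t x
  map_add' p q := by
    rw [← integral_add (integrableOn_eval_mul_weight_sub_one hα ht p)
      (integrableOn_eval_mul_weight_sub_one hα ht q)]
    simp [add_mul]
  map_smul' c p := by
    simp only [eval_smul, smul_eq_mul, mul_assoc, integral_const_mul, RingHom.id_apply]

variable {α t : ℝ} (hα : -1 < α) (ht : 0 < t)

lemma invMoment_apply (p : ℝ[X]) :
    invMoment hα ht p = ∫ x in Ioi (0 : ℝ), p.eval x * weight (α - 1) t x := rfl

lemma invMoment_C_mul (c : ℝ) (p : ℝ[X]) :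
    invMoment hα ht (C c * p) = c * invMoment hα ht p := by
  rw [← smul_eq_C_mul, map_smul, smul_eq_mul]

lemma invMoment_X_mul (p q : ℝ[X]) : invMoment hα ht (X * (p * q)) = inn α t p q := by
  refine setIntegral_congr_fun measurableSet_Ioi fun x hx => ?_
  have hx0 : x ≠ 0 := (mem_Ioi.1 hx).ne'
  simp only [weight, Real.rpow_sub_one hx0, eval_mul, eval_X]
  field_simp

lemma invMoment_mul_self_nonneg (p : ℝ[X]) : 0 ≤ invMoment hα ht (p * p) := by
  refine setIntegral_nonneg measurableSet_Ioi fun x hx => ?_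
  rw [eval_mul]
  exact mul_nonneg (mul_self_nonneg _) (weight_pos _ _ hx).le

/-- If L(p²) = 0, then L((p - c x p)²) = -2c⟨p,p⟩ + c²⟨xp,p⟩, which is negative for small c > 0. -/
lemma invMoment_mul_self_pos {p : ℝ[X]} (hp : p ≠ 0) : 0 < invMoment hα ht (p * p) := by
  refine (invMoment_mul_self_nonneg hα ht p).lt_of_ne' fun h0 => ?_
  have hh := inn_self_pos hα ht.le hp
  have key : ∀ c : ℝ, 0 ≤ -2 * c * inn α t p p + c ^ 2 * inn α t (X * p) p := fun c => by
    have h := invMoment_mul_self_nonneg hα ht (p - C c * (X * p))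
    have h1 : (p - C c * (X * p)) * (p - C c * (X * p)) =
        p * p - C (2 * c) * (X * (p * p)) + C (c ^ 2) * (X * (X * p * p)) := by
      simp only [C_mul, C_pow, map_ofNat]
      ring
    rw [h1, map_add, map_sub, invMoment_C_mul, invMoment_C_mul, invMoment_X_mul,
      invMoment_X_mul, h0] at h
    linarith
  have hk := key (inn α t p p / (|inn α t (X * p) p| + 1))
  set m := |inn α t (X * p) p| with hm
  have hm0 : 0 ≤ m := abs_nonneg _
  have hle : inn α t (X * p) p ≤ m := le_abs_self _
  set c := inn α t p p / (m + 1) with hc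
  have hc0 : 0 < c := by positivity
  have hcm : c * (m + 1) = inn α t p p := div_mul_cancel₀ _ (by positivity)
  nlinarith [mul_pos hc0 hc0, mul_nonneg (mul_pos hc0 hc0).le hm0,
    mul_le_mul_of_nonneg_left hle (sq_nonneg c)]

/-- The exponent α + 1 clears the x⁻² coming from the derivative of -t/x, so the result is a
polynomial times w/x and L applies to it. -/
lemma hasDerivAt_eval_mul_weight (α t : ℝ) (p : ℝ[X]) {x : ℝ} (hx : 0 < x) :
    HasDerivAt (fun x => p.eval x * weight (α + 1) t x)
      ((X ^ 2 * derivative p + (C t + C (α + 1) * X - X ^ 2) * p).eval x * weight (α - 1) t x)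
      x := by
  have h1 := Real.hasDerivAt_rpow_const (p := α + 1) (Or.inl hx.ne')
  have h2 : HasDerivAt (fun x => -x - t / x) (-1 + t / x ^ 2) x := by
    have := ((hasDerivAt_id x).neg).sub ((hasDerivAt_inv hx.ne').const_mul t)
    refine this.congr_deriv ?_
    field_simp
    ring
  refine ((p.hasDerivAt x).mul (h1.mul h2.exp)).congr_deriv ?_
  have h3 : x ^ (α + 1) = x ^ (α - 1) * x ^ 2 := by
    rw [← Real.rpow_natCast, ← Real.rpow_add hx]
    congr 1
    push_cast
    ring
  have h4 : x ^ (α + 1 - 1) = x ^ (α - 1) * x := by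
    rw [← Real.rpow_add_one hx.ne']
    ring_nf
  simp only [weight, h3, h4, eval_add, eval_mul, eval_sub, eval_pow, eval_X, eval_C, Pi.mul_apply]
  field_simp
  ring

lemma continuousWithinAt_eval_mul_weight {α t : ℝ} (hα : -1 < α) (ht : 0 < t) (p : ℝ[X]) :
    ContinuousWithinAt (fun x => p.eval x * weight (α + 1) t x) (Ici 0) 0 := by
  have h0 : (0 : ℝ) ^ (α + 1) = 0 := Real.zero_rpow (by linarith)
  have hlim : Tendsto (fun x : ℝ => |p.eval x| * x ^ (α + 1)) (nhdsWithin 0 (Ici 0)) (nhds 0) := by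
    have : Continuous fun x : ℝ => |p.eval x| * x ^ (α + 1) :=
      p.continuous.abs.mul (Real.continuous_rpow_const (by linarith))
    have := (this.tendsto 0).mono_left (nhdsWithin_le_nhds (s := Ici 0))
    simpa [h0] using this
  rw [ContinuousWithinAt]
  simp only [weight, h0, zero_mul, mul_zero]
  refine squeeze_zero_norm' ?_ hlim
  filter_upwards [self_mem_nhdsWithin] with x hx
  have hx : 0 ≤ x := hx
  have hr := Real.rpow_nonneg hx (α + 1)
  have he : Real.exp (-x - t / x) ≤ 1 :=
    Real.exp_le_one_iff.2 (by have := div_nonneg ht.le hx; linarith)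
  rw [norm_mul, Real.norm_eq_abs, Real.norm_of_nonneg (mul_nonneg hr (Real.exp_pos _).le)]
  exact mul_le_mul_of_nonneg_left (mul_le_of_le_one_right hr he) (abs_nonneg _)

/-- Integration by parts against the weight. -/
lemma invMoment_pearson (p : ℝ[X]) :
    invMoment hα ht (X ^ 2 * derivative p + (C t + C (α + 1) * X - X ^ 2) * p) = 0 := by
  have hd := fun x (hx : x ∈ Ioi (0 : ℝ)) => hasDerivAt_eval_mul_weight α t p (mem_Ioi.1 hx)
  have hi := integrableOn_eval_mul_weight_sub_one hα ht
    (X ^ 2 * derivative p + (C t + C (α + 1) * X - X ^ 2) * p)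
  have hlim := tendsto_zero_of_hasDerivAt_of_integrableOn_Ioi hd hi
    (integrableOn_eval_mul_weight (by linarith) ht.le p)
  rw [invMoment_apply, integral_Ioi_of_hasDerivAt_of_tendsto
    (continuousWithinAt_eval_mul_weight hα ht p) hd hi hlim]
  simp [weight, Real.zero_rpow (by linarith : α + 1 ≠ 0)]

end

/-! ### The Laguerre–Freud equations. -/

section

lemma normConst_succ {α t : ℝ} (hα : -1 < α) (ht : 0 ≤ t) (n : ℕ) :
    normConst α t (n + 1) = recB α t (n + 1) * normConst α t n := by
  have hlt : (X * orthoPoly α t n - orthoPoly α t (n + 1)).degree < ((n + 1 : ℕ) : WithBot ℕ) := by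
    have hm : (X * orthoPoly α t n).Monic := monic_X.mul (orthoPoly_monic α t n)
    have hd : (X * orthoPoly α t n).degree = ((n + 1 : ℕ) : WithBot ℕ) := by
      rw [degree_mul, degree_X, degree_orthoPoly, Nat.cast_add, add_comm, Nat.cast_one]
    rw [← hd]
    refine degree_sub_lt_left (by rw [hd, degree_orthoPoly]) hm.ne_zero ?_
    rw [hm.leadingCoeff, (orthoPoly_monic α t (n + 1)).leadingCoeff]
  have h := inn_orthoPoly_of_degree_lt hα ht (n + 1) _ hlt
  rw [inn_comm, inn_sub hα ht, inn_comm α t _ (orthoPoly α t (n + 1)), ← inn_X_mul] at h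
  rw [recB, div_mul_cancel₀ _ (inn_orthoPoly_self_pos hα ht n).ne', normConst]
  linarith

lemma recB_succ_pos {α t : ℝ} (hα : -1 < α) (ht : 0 ≤ t) (n : ℕ) : 0 < recB α t (n + 1) := by
  have h := inn_orthoPoly_self_pos hα ht (n + 1)
  rw [normConst_succ hα ht] at h
  exact pos_of_mul_pos_left h (inn_orthoPoly_self_pos hα ht n).le

/-- The three-term recurrence, with the convention that the last term vanishes for `n = 0`. -/
lemma three_term {α t : ℝ} (hα : -1 < α) (ht : 0 ≤ t) (n : ℕ) :
    X * orthoPoly α t n = orthoPoly α t (n + 1) + C (recA α t n) * orthoPoly α t n +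
      C (recB α t n) * orthoPoly α t (n - 1) := by
  cases n with
  | zero => simpa [recB] using three_term_zero hα ht
  | succ n => exact three_term_succ hα ht n

lemma coeff_orthoPoly_self (α t : ℝ) (n : ℕ) : (orthoPoly α t n).coeff n = 1 := by
  have := (orthoPoly_monic α t n).coeff_natDegree
  rwa [natDegree_orthoPoly] at this

lemma coeff_orthoPoly_of_lt (α t : ℝ) {n i : ℕ} (h : n < i) : (orthoPoly α t n).coeff i = 0 :=
  coeff_eq_zero_of_natDegree_lt (by rwa [natDegree_orthoPoly])

/-- The inner product of `P_n` with a polynomial of degree at most `n`. -/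
lemma inn_orthoPoly_of_degree_le {α t : ℝ} (hα : -1 < α) (ht : 0 ≤ t) (n : ℕ) (q : ℝ[X])
    (hq : q.degree ≤ n) : inn α t (orthoPoly α t n) q = q.coeff n * normConst α t n := by
  have hlt : (q - C (q.coeff n) * orthoPoly α t n).degree < n := by
    rw [degree_lt_iff_coeff_zero]
    intro i hi
    rcases hi.eq_or_lt with rfl | hi
    · simp [coeff_orthoPoly_self]
    · simp [coeff_orthoPoly_of_lt α t hi,
        coeff_eq_zero_of_degree_lt (hq.trans_lt (WithBot.coe_lt_coe.2 hi))]
  have h := inn_orthoPoly_of_degree_lt hα ht n _ hlt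
  rw [inn_comm, inn_sub hα ht, inn_C_mul, inn_comm α t q] at h
  rw [normConst]
  linarith

/-- The subleading coefficient of `P_{n+1}`. -/
lemma coeff_orthoPoly_succ {α t : ℝ} (hα : -1 < α) (ht : 0 ≤ t) (n : ℕ) :
    (orthoPoly α t (n + 1)).coeff n = -∑ j ∈ Finset.range (n + 1), recA α t j := by
  induction n with
  | zero =>
    have h := congrArg (fun p => p.coeff 0) (three_term_zero hα ht)
    simp [coeff_orthoPoly_self] at h
    simp
    linarith
  | succ n ih =>
    have h := congrArg (fun p => p.coeff (n + 1)) (three_term_succ hα ht n)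
    simp [coeff_X_mul, coeff_orthoPoly_self, coeff_orthoPoly_of_lt] at h
    rw [Finset.sum_range_succ]
    linarith

lemma degree_X_mul_derivative_le (p : ℝ[X]) : (X * derivative p).degree ≤ p.degree := by
  rw [degree_le_iff_coeff_zero]
  intro i hi
  cases i with
  | zero => simp
  | succ i => rw [coeff_X_mul, coeff_derivative, coeff_eq_zero_of_degree_lt hi, zero_mul]

lemma coeff_X_mul_derivative (p : ℝ[X]) (i : ℕ) : (X * derivative p).coeff i = i * p.coeff i := by
  cases i with
  | zero => simp
  | succ i => rw [coeff_X_mul, coeff_derivative, mul_comm]; push_cast; ring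

lemma inn_X_mul_derivative_self {α t : ℝ} (hα : -1 < α) (ht : 0 ≤ t) (n : ℕ) :
    inn α t (X * derivative (orthoPoly α t n)) (orthoPoly α t n) = n * normConst α t n := by
  rw [inn_comm, inn_orthoPoly_of_degree_le hα ht, coeff_X_mul_derivative, coeff_orthoPoly_self,
    mul_one]
  exact (degree_X_mul_derivative_le _).trans (degree_orthoPoly α t n).le

/-- Subtracting (n+1)P_{n+1} from xP'_{n+1} kills the leading term and leaves minus the subleading
coefficient of P_{n+1} at xⁿ, which is the sum of the α_j. -/
lemma inn_X_mul_derivative_succ {α t : ℝ} (hα : -1 < α) (ht : 0 ≤ t) (n : ℕ) :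
    inn α t (X * derivative (orthoPoly α t (n + 1))) (orthoPoly α t n) =
      (∑ j ∈ Finset.range (n + 1), recA α t j) * normConst α t n := by
  set P := orthoPoly α t (n + 1) with hP
  have hle : (X * derivative P - C ((n : ℝ) + 1) * P).degree ≤ (n : WithBot ℕ) := by
    rw [degree_le_iff_coeff_zero]
    intro i hi
    have hi' : n + 1 ≤ i := WithBot.coe_lt_coe.1 hi
    rw [coeff_sub, coeff_X_mul_derivative, coeff_C_mul]
    rcases hi'.eq_or_lt with rfl | h
    · push_cast
      ring
    · rw [hP, coeff_orthoPoly_of_lt α t h]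
      ring
  have h := inn_orthoPoly_of_degree_le hα ht n _ hle
  rw [inn_comm, inn_sub hα ht, inn_C_mul, inn_orthoPoly_of_lt hα ht (n + 1) n n.lt_succ_self,
    coeff_sub, coeff_X_mul_derivative, coeff_C_mul, hP, coeff_orthoPoly_succ hα ht] at h
  rw [hP]
  linarith

variable {α t : ℝ} (hα : -1 < α) (ht : 0 < t)

/-- Integration by parts against the weight, in terms of the inner product. -/
lemma inn_pearson (p q : ℝ[X]) :
    inn α t (X * derivative p) q + inn α t p (X * derivative q) + (α + 1) * inn α t p q -
      inn α t (X * p) q + t * invMoment hα ht (p * q) = 0 := by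
  have h := invMoment_pearson hα ht (p * q)
  have h1 : X ^ 2 * derivative (p * q) + (C t + C (α + 1) * X - X ^ 2) * (p * q) =
      X * (X * derivative p * q) + X * (p * (X * derivative q)) + C (α + 1) * (X * (p * q)) -
        X * (X * p * q) + C t * (p * q) := by
    rw [derivative_mul]
    ring
  rw [h1] at h
  rwa [map_add, map_sub, map_add, map_add, invMoment_C_mul, invMoment_C_mul, invMoment_X_mul,
    invMoment_X_mul, invMoment_X_mul, invMoment_X_mul] at h

lemma recA_eq (n : ℕ) : recA α t n = 2 * n + 1 + α +
    t * invMoment hα ht (orthoPoly α t n * orthoPoly α t n) / normConst α t n := by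
  have h := inn_pearson hα ht (orthoPoly α t n) (orthoPoly α t n)
  have hn := (inn_orthoPoly_self_pos hα ht.le n).ne'
  rw [inn_comm α t (orthoPoly α t n) (X * derivative _), inn_X_mul_derivative_self hα ht.le] at h
  change _ + _ + (α + 1) * normConst α t n - _ + _ = 0 at h
  rw [recA]
  field_simp
  linarith

lemma recB_succ_eq (n : ℕ) : recB α t (n + 1) = ∑ j ∈ Finset.range (n + 1), recA α t j +
    t * invMoment hα ht (orthoPoly α t (n + 1) * orthoPoly α t n) / normConst α t n := by
  have h := inn_pearson hα ht (orthoPoly α t (n + 1)) (orthoPoly α t n)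
  have hn := (inn_orthoPoly_self_pos hα ht.le n).ne'
  have h0 : inn α t (orthoPoly α t (n + 1)) (X * derivative (orthoPoly α t n)) = 0 := by
    refine inn_orthoPoly_of_degree_lt hα ht.le _ _ ((degree_X_mul_derivative_le _).trans_lt ?_)
    rw [degree_orthoPoly]
    exact_mod_cast n.lt_succ_self
  rw [inn_X_mul_derivative_succ hα ht.le, h0,
    inn_orthoPoly_of_lt hα ht.le (n + 1) n n.lt_succ_self] at h
  rw [recB]
  field_simp
  linarith

lemma invMoment_three_term (n : ℕ) (q : ℝ[X]) :
    invMoment hα ht (orthoPoly α t (n + 1) * q) + recA α t n * invMoment hα ht (orthoPoly α t n * q)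
      + recB α t n * invMoment hα ht (orthoPoly α t (n - 1) * q) = inn α t (orthoPoly α t n) q := by
  rw [← invMoment_X_mul hα ht, ← mul_assoc, three_term hα ht.le n]
  simp only [add_mul, mul_assoc, map_add, invMoment_C_mul]

/-- Division with remainder by `X` under the functional. -/
lemma invMoment_mul_eq (p q : ℝ[X]) :
    invMoment hα ht (p * q) = inn α t p (divX q) + q.coeff 0 * invMoment hα ht p := by
  rw [← invMoment_X_mul hα ht, ← invMoment_C_mul, ← map_add]
  congr 1
  nth_rewrite 1 [← divX_mul_X_add q]
  ring

/-- Write q = x r + q(0): here deg r < n, so the part x r contributes ⟨P_n, r⟩ = 0. -/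
lemma invMoment_orthoPoly_mul (n : ℕ) (q : ℝ[X]) (hq : q.degree ≤ n) :
    invMoment hα ht (orthoPoly α t n * q) =
      q.coeff 0 * invMoment hα ht (orthoPoly α t n) := by
  rw [invMoment_mul_eq, inn_orthoPoly_of_degree_lt hα ht.le, zero_add]
  rw [degree_lt_iff_coeff_zero]
  intro i hi
  rw [coeff_divX]
  exact coeff_eq_zero_of_degree_lt (hq.trans_lt (WithBot.coe_lt_coe.2 (Nat.lt_succ_of_le hi)))

lemma invMoment_orthoPoly_mul_succ (n : ℕ) :
    invMoment hα ht (orthoPoly α t n * orthoPoly α t (n + 1)) =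
      normConst α t n + (orthoPoly α t (n + 1)).coeff 0 * invMoment hα ht (orthoPoly α t n) := by
  rw [invMoment_mul_eq, inn_orthoPoly_of_degree_le hα ht.le, coeff_divX, coeff_orthoPoly_self,
    one_mul]
  rw [degree_le_iff_coeff_zero]
  intro i hi
  rw [coeff_divX, coeff_orthoPoly_of_lt]
  have : n < i := WithBot.coe_lt_coe.1 hi
  omega

/-- Both sides equal P_{n+1}(0) L(P_{n+1}) P_n(0) L(P_n): the mixed value L(P_{n+1}P_n) is P_n(0)
L(P_{n+1}) and also h_n + P_{n+1}(0) L(P_n). -/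
lemma invMoment_mul_self_mul (n : ℕ) :
    invMoment hα ht (orthoPoly α t (n + 1) * orthoPoly α t (n + 1)) *
        invMoment hα ht (orthoPoly α t n * orthoPoly α t n) =
      invMoment hα ht (orthoPoly α t (n + 1) * orthoPoly α t n) *
        (invMoment hα ht (orthoPoly α t (n + 1) * orthoPoly α t n) - normConst α t n) := by
  have h1 := invMoment_orthoPoly_mul hα ht (n + 1) _ (degree_orthoPoly α t (n + 1)).le
  have h2 := invMoment_orthoPoly_mul hα ht n _ (degree_orthoPoly α t n).le
  have h3 := invMoment_orthoPoly_mul hα ht (n + 1) (orthoPoly α t n) (by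
    rw [degree_orthoPoly]
    exact_mod_cast n.le_succ)
  have h4 := invMoment_orthoPoly_mul_succ hα ht n
  rw [mul_comm (orthoPoly α t n) (orthoPoly α t (n + 1)), ← sub_eq_iff_eq_add'] at h4
  rw [h4, h1, h2, h3]
  ring

/-- The discrete system of Laguerre–Freud type satisfied by `a_n = α_n - (2 n + 1 + α)`, `β_n` and
an auxiliary quantity `b_n`. -/
theorem exists_laguerreFreud {α t : ℝ} (hα : -1 < α) (ht : 0 < t) :
    ∃ b : ℕ → ℝ, b 0 = 0 ∧ ∀ n : ℕ,
    0 < recA α t n - (2 * n + 1 + α) ∧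
    b (n + 1) + b n = t - recA α t n * (recA α t n - (2 * n + 1 + α)) ∧
    recB α t (n + 1) * (recA α t (n + 1) - (2 * (n + 1) + 1 + α) +
      (recA α t n - (2 * n + 1 + α))) = (n + 1) * t - (2 * (n + 1) + α) * b (n + 1) ∧
    b (n + 1) * (b (n + 1) - t) = recB α t (n + 1) *
      (recA α t (n + 1) - (2 * (n + 1) + 1 + α)) * (recA α t n - (2 * n + 1 + α)) := by
  set L := invMoment hα ht with hL
  set P := orthoPoly α t with hP
  set h := normConst α t with hh
  have hpos : ∀ n, 0 < h n := inn_orthoPoly_self_pos hα ht.le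
  have hne : ∀ n, h n ≠ 0 := fun n => (hpos n).ne'
  set a : ℕ → ℝ := fun n => t * L (P n * P n) / h n with ha
  set b : ℕ → ℝ := fun n => if n = 0 then 0 else t * L (P n * P (n - 1)) / h (n - 1) with hb
  have hb0 : b 0 = 0 := by simp [hb]
  have hbs : ∀ n, b (n + 1) = t * L (P (n + 1) * P n) / h n := fun n => by simp [hb]
  have haeq : ∀ n : ℕ, recA α t n - (2 * n + 1 + α) = a n := fun n => by
    rw [recA_eq hα ht]
    simp only [ha, hL, hP, hh]
    ring
  have hns : ∀ n, h (n + 1) = recB α t (n + 1) * h n := normConst_succ hα ht.le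
  have ham : ∀ n, t * L (P n * P n) = a n * h n := fun n => by
    simp only [ha]; rw [div_mul_cancel₀ _ (hne n)]
  have hbm : ∀ n, t * L (P (n + 1) * P n) = b (n + 1) * h n := fun n => by
    rw [hbs, div_mul_cancel₀ _ (hne n)]
  -- This is L(x P_n P_n) = h_n, with x P_n expanded by the recurrence.
  have hE2 : ∀ n, b (n + 1) + b n = t - recA α t n * a n := fun n => by
    have h3 := invMoment_three_term hα ht n (P n)
    rw [← hL, ← hP] at h3
    change _ = h n at h3
    have h4 : b n * h n = recB α t n * (t * L (P (n - 1) * P n)) := by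
      cases n with
      | zero => simp [hb0, recB]
      | succ n => rw [Nat.add_sub_cancel, mul_comm (P n), hbm, hns]; ring
    have h5 : (b (n + 1) + b n) * h n = (t - recA α t n * a n) * h n := by
      linear_combination t * h3 + h4 - hbm n - recA α t n * ham n
    exact mul_right_cancel₀ (hne n) h5
  -- For n ≥ 1, expand x P_n in L(x P_n P_{n+1}) = 0 and L(x P_n P_{n-1}) = 0, and eliminate
  -- L(P_{n+1} P_{n-1}). For n = 0 the first relation suffices, as β_0 = 0.
  have hS : ∀ n, recB α t (n + 1) * a (n + 1) - recB α t n * a (n - 1) =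
      -recA α t n * (b (n + 1) - b n) := fun n => by
    have h3 := invMoment_three_term hα ht n (P (n + 1))
    have h30 : inn α t (P n) (P (n + 1)) = 0 := by
      rw [inn_comm]; exact inn_orthoPoly_of_lt hα ht.le (n + 1) n n.lt_succ_self
    rw [← hL, ← hP, h30] at h3
    refine mul_right_cancel₀ (hne n) ?_
    rw [mul_comm (P n)] at h3
    cases n with
    | zero =>
      simp only [recB, zero_mul, hb0, sub_zero, add_zero] at h3 ⊢
      have := hns 0
      simp only [zero_add] at this h3 ⊢
      have h6 := ham 1
      have h7 := hbm 0
      simp only [zero_add] at h6 h7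
      simp only [recB, zero_add] at this ⊢
      linear_combination t * h3 - h6 - recA α t 0 * h7 - a 1 * this
    | succ n =>
      have h4 := invMoment_three_term hα ht (n + 1) (P n)
      have h40 : inn α t (P (n + 1)) (P n) = 0 :=
        inn_orthoPoly_of_lt hα ht.le (n + 1) n n.lt_succ_self
      rw [← hL, ← hP, h40] at h4
      rw [Nat.add_sub_cancel] at h3 h4 ⊢
      rw [mul_comm (P n)] at h3
      have e1 := ham (n + 2)
      have e2 := hbm (n + 1)
      have e3 := hbm n
      have e4 := ham n
      have e5 := hns (n + 1)
      have e6 := hns n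
      linear_combination t * h3 - t * recB α t (n + 1) * h4 - e1 - recA α t (n + 1) * e2 +
        recB α t (n + 1) * recA α t (n + 1) * e3 + recB α t (n + 1) ^ 2 * e4 - a (n + 2) * e5
        - recB α t (n + 1) * a n * e6 - recA α t (n + 1) * b (n + 1) * e6
  have hE3 : ∀ n, recB α t (n + 1) - recB α t n = recA α t n + b (n + 1) - b n := fun n => by
    have h1 := recB_succ_eq hα ht n
    rw [← hL, ← hP, ← hh, ← hbs, Finset.sum_range_succ] at h1
    cases n with
    | zero => simp only [recB] at h1 ⊢; simp at h1 ⊢; linarith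
    | succ n =>
      have h2 := recB_succ_eq hα ht n
      rw [← hL, ← hP, ← hh, ← hbs] at h2
      linarith
  -- The relation telescopes: its increment in n is a combination of `hS`, `hE3` and `hE2`, and both
  -- sides vanish at n = 0.
  have hE4 : ∀ n : ℕ, recB α t n * (a n + a (n - 1)) = n * t - (2 * n + α) * b n := fun n => by
    induction n with
    | zero => simp [recB, hb0]
    | succ n ih =>
      rw [Nat.add_sub_cancel]
      have e1 := hS n
      have e2 := hE3 n
      have e3 := hE2 n
      have e4 := haeq n
      push_cast
      linear_combination ih + e1 + a n * e2 + e3 - (b (n + 1) - b n) * e4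
  refine ⟨b, hb0, fun n => ?_⟩
  have hcast := haeq (n + 1)
  push_cast at hcast
  rw [hcast, haeq]
  refine ⟨?_, hE2 n, ?_, ?_⟩
  · exact div_pos (mul_pos ht (invMoment_mul_self_pos hα ht (orthoPoly_monic α t n).ne_zero))
      (hpos n)
  · simpa using hE4 (n + 1)
  · have h1 := invMoment_mul_self_mul hα ht n
    rw [← hL, ← hP, ← hh] at h1
    refine mul_right_cancel₀ (mul_ne_zero (hne n) (hne n)) ?_
    have e1 := ham (n + 1)
    rw [hns] at e1
    linear_combination (-t ^ 2) * h1 - (b (n + 1) * h n - t * h n + t * L (P (n + 1) * P n)) * hbm n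
      + t * L (P n * P n) * e1 + recB α t (n + 1) * a (n + 1) * h n * ham n

end

/-! ### The scaled system and its a priori bounds. -/

/-- The rescaled discrete system: `s = t ^ (-1/2)`, and `A`, `D`, `B` are `s` times the sequences
`α_n - (2 n + 1 + α)`, `β_n`, `b_n`. -/
structure IsScaledSystem (α s : ℝ) (A D B : ℕ → ℝ) : Prop where
  B_zero : B 0 = 0
  D_zero : D 0 = 0
  A_pos : ∀ n, 0 < A n
  D_pos : ∀ n, 0 < D (n + 1)
  A_eq : ∀ n : ℕ, A n * (A n + (2 * n + 1 + α) * s) = 1 - s * (B n + B (n + 1))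
  D_eq : ∀ n : ℕ, D (n + 1) * (A (n + 1) + A n) = (n + 1) - (2 * (n + 1) + α) * (s * B (n + 1))
  B_eq : ∀ n : ℕ, B (n + 1) * (1 - s * B (n + 1)) = -(D (n + 1) * A (n + 1) * A n)

namespace IsScaledSystem

variable {α s : ℝ} {A D B : ℕ → ℝ}

/-- Put m = n + 1. Positivity in `D_eq` gives (2m+α) s B_m < m, hence s B_m < 1 because m + α > 0;
then `B_eq` fixes the sign. -/
lemma B_succ_neg (H : IsScaledSystem α s A D B) (hα : -1 < α) (n : ℕ) : B (n + 1) < 0 := by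
  have hn : (0 : ℝ) ≤ n := n.cast_nonneg
  have h1 := mul_pos (H.D_pos n) (add_pos (H.A_pos (n + 1)) (H.A_pos n))
  have h2 := mul_pos (mul_pos (H.D_pos n) (H.A_pos (n + 1))) (H.A_pos n)
  rw [H.D_eq] at h1
  have h3 : 0 < 1 - s * B (n + 1) := by
    by_contra! h
    nlinarith
  have h4 := H.B_eq n
  exact neg_of_mul_neg_left (by linarith : B (n + 1) * (1 - s * B (n + 1)) < 0) h3.le

lemma B_nonpos (H : IsScaledSystem α s A D B) (hα : -1 < α) (n : ℕ) : B n ≤ 0 := by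
  cases n with
  | zero => exact H.B_zero.le
  | succ n => exact (H.B_succ_neg hα n).le

/-- In `B_eq`, bound D A_{n+1} by D (A_{n+1} + A_n), which `D_eq` evaluates; the factor 1 - s
B_{n+1} > 0 then cancels. -/
lemma neg_B_succ_le (H : IsScaledSystem α s A D B) (hα : -1 < α) (hs : 0 < s) (n : ℕ) :
    -B (n + 1) ≤ (2 * (n + 1) + α) * A n := by
  have hn : (0 : ℝ) ≤ n := n.cast_nonneg
  have hB := H.B_succ_neg hα n
  have hA := H.A_pos n
  have hsB : 0 < -(s * B (n + 1)) := by nlinarith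
  have h1 : -B (n + 1) * (1 - s * B (n + 1)) ≤
      ((n + 1) - (2 * (n + 1) + α) * (s * B (n + 1))) * A n := by
    rw [← H.D_eq, neg_mul, H.B_eq]
    nlinarith [mul_pos (H.D_pos n) (mul_pos hA hA)]
  have h2 : ((n + 1) - (2 * (n + 1) + α) * (s * B (n + 1))) * A n ≤
      (2 * (n + 1) + α) * A n * (1 - s * B (n + 1)) := by
    nlinarith [mul_pos (by linarith : 0 < n + 1 + α) hA]
  exact le_of_mul_le_mul_right (h1.trans h2) (by linarith)

end IsScaledSystem

/-- With c = 2(n+1) + α and |B_n| ≤ K, `A_eq` and -B_{n+1} ≤ c A_n give A_n² ≤ 1 + K + c A_n. Hence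
A_n ≤ 1 + K + c, uniformly in s. -/
lemma exists_bound_scaledSystem {α : ℝ} (hα : -1 < α) (n : ℕ) : ∃ K : ℝ, 0 ≤ K ∧
    ∀ (s : ℝ) (A D B : ℕ → ℝ), 0 < s → s ≤ 1 → IsScaledSystem α s A D B → |B n| ≤ K := by
  induction n with
  | zero => exact ⟨0, le_rfl, fun s A D B _ _ H => by simp [H.B_zero]⟩
  | succ n ih =>
    obtain ⟨K, hK, h⟩ := ih
    have hn : (0 : ℝ) ≤ n := n.cast_nonneg
    have hm : 0 < 2 * ((n : ℝ) + 1) + α := by linarith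
    refine ⟨(2 * (n + 1) + α) * (1 + K + (2 * (n + 1) + α)), by positivity, ?_⟩
    intro s A D B hs hs1 H
    have hB := (abs_le.1 (h s A D B hs hs1 H)).1
    have hB' := H.neg_B_succ_le hα hs n
    have hA := H.A_pos n
    rw [abs_of_neg (H.B_succ_neg hα n)]
    refine hB'.trans (mul_le_mul_of_nonneg_left ?_ hm.le)
    by_contra! hlt
    have h1 := H.A_eq n
    have h2 : 0 ≤ A n * ((2 * n + 1 + α) * s) := by
      have : 0 ≤ 2 * (n : ℝ) + 1 + α := by linarith
      positivity
    have h3 : s * (-(B n + B (n + 1))) ≤ K + (2 * (n + 1) + α) * A n :=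
      (mul_le_of_le_one_left (by linarith [H.B_nonpos hα n, H.B_nonpos hα (n + 1)]) hs1).trans
        (by linarith)
    nlinarith

/-! ### The truncated expansions and their residuals. -/

/-- Truncated expansion of the `A_n` of the scaled system. -/
def expA (α n s : ℝ) : ℝ :=
  1 - (2 * α + 2 * n + 1) / 4 * s + (2 * α + 2 * n + 1) * (2 * α + 6 * n + 3) / 32 * s ^ 2
    - (2 * α + 2 * n + 1) * (α * (4 * n + 2) + 8 * n ^ 2 + 8 * n + 3) / 64 * s ^ 3

/-- Truncated expansion of the `D_n` of the scaled system. -/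
def expD (α n s : ℝ) : ℝ :=
  n / 2 + (2 * α * n + 3 * n ^ 2) / 4 * s
    + 3 * n * (2 * α + 2 * n + 1) * (2 * α + 2 * n - 1) / 64 * s ^ 2
    - n ^ 2 * (2 * α + 2 * n + 1) * (2 * α + 2 * n - 1) / 32 * s ^ 3

/-- Truncated expansion of the `B_n` of the scaled system. -/
def expB (α n s : ℝ) : ℝ :=
  -(n / 2) + n * (2 * α + 2 * n + 1) * (2 * α + 2 * n - 1) / 64 * s ^ 2
    - n ^ 2 * (2 * α + 2 * n + 1) * (2 * α + 2 * n - 1) / 64 * s ^ 3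

lemma continuous_expA (α n : ℝ) : Continuous (expA α n) := by unfold expA; fun_prop
lemma continuous_expD (α n : ℝ) : Continuous (expD α n) := by unfold expD; fun_prop
lemma continuous_expB (α n : ℝ) : Continuous (expB α n) := by unfold expB; fun_prop

/-- The product of two cubic polynomials modulo the fourth power of the variable. -/
lemma exists_mul_cubic (a₀ a₁ a₂ a₃ b₀ b₁ b₂ b₃ : ℝ) : ∃ Q : ℝ → ℝ, Continuous Q ∧ ∀ s,
    (a₀ + a₁ * s + a₂ * s ^ 2 + a₃ * s ^ 3) * (b₀ + b₁ * s + b₂ * s ^ 2 + b₃ * s ^ 3) =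
      a₀ * b₀ + (a₀ * b₁ + a₁ * b₀) * s + (a₀ * b₂ + a₁ * b₁ + a₂ * b₀) * s ^ 2 +
        (a₀ * b₃ + a₁ * b₂ + a₂ * b₁ + a₃ * b₀) * s ^ 3 + s ^ 4 * Q s :=
  ⟨fun s => a₁ * b₃ + a₂ * b₂ + a₃ * b₁ + (a₂ * b₃ + a₃ * b₂) * s + a₃ * b₃ * s ^ 2,
    by fun_prop, fun s => by ring⟩

lemma exists_expA_eq (α n : ℝ) : ∃ Q : ℝ → ℝ, Continuous Q ∧ ∀ s,
    expA α n s * (expA α n s + (2 * n + 1 + α) * s) =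
      1 - s * (expB α n s + expB α (n + 1) s) + s ^ 4 * Q s := by
  obtain ⟨Q, hQ, h⟩ := exists_mul_cubic
    1 (-((2 * α + 2 * n + 1) / 4)) ((2 * α + 2 * n + 1) * (2 * α + 6 * n + 3) / 32)
      (-((2 * α + 2 * n + 1) * (α * (4 * n + 2) + 8 * n ^ 2 + 8 * n + 3) / 64))
    1 (-((2 * α + 2 * n + 1) / 4) + (2 * n + 1 + α))
      ((2 * α + 2 * n + 1) * (2 * α + 6 * n + 3) / 32)
      (-((2 * α + 2 * n + 1) * (α * (4 * n + 2) + 8 * n ^ 2 + 8 * n + 3) / 64))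
  -- The two subtracted constants are the s⁴ terms of s (`expB α n s` + `expB α (n + 1) s`), moved
  -- into the residual.
  refine ⟨fun s => Q s - n ^ 2 * (2 * α + 2 * n + 1) * (2 * α + 2 * n - 1) / 64 -
    (n + 1) ^ 2 * (2 * α + 2 * n + 3) * (2 * α + 2 * n + 1) / 64, by fun_prop, fun s => ?_⟩
  have hs := h s
  unfold expA expB
  linear_combination hs

lemma exists_expD_eq (α n : ℝ) : ∃ Q : ℝ → ℝ, Continuous Q ∧ ∀ s,
    expD α n s * (expA α n s + expA α (n - 1) s) =
      n - (2 * n + α) * (s * expB α n s) + s ^ 4 * Q s := by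
  obtain ⟨Q, hQ, h⟩ := exists_mul_cubic
    (n / 2) ((2 * α * n + 3 * n ^ 2) / 4)
      (3 * n * (2 * α + 2 * n + 1) * (2 * α + 2 * n - 1) / 64)
      (-(n ^ 2 * (2 * α + 2 * n + 1) * (2 * α + 2 * n - 1) / 32))
    2 (-(α + n))
      (((2 * α + 2 * n + 1) * (2 * α + 6 * n + 3) + (2 * α + 2 * n - 1) * (2 * α + 6 * n - 3)) / 32)
      (-((2 * α + 2 * n + 1) * (α * (4 * n + 2) + 8 * n ^ 2 + 8 * n + 3) +
        (2 * α + 2 * n - 1) * (α * (4 * n - 2) + 8 * n ^ 2 - 8 * n + 3)) / 64)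
  refine ⟨fun s => Q s - (2 * n + α) * (n ^ 2 * (2 * α + 2 * n + 1) * (2 * α + 2 * n - 1) / 64),
    by fun_prop, fun s => ?_⟩
  have hs := h s
  unfold expA expB expD
  linear_combination hs

lemma exists_expB_eq (α n : ℝ) : ∃ Q : ℝ → ℝ, Continuous Q ∧ ∀ s,
    expB α n s * (1 - s * expB α n s) =
      -(expD α n s * expA α n s * expA α (n - 1) s) + s ^ 4 * Q s := by
  obtain ⟨Q₁, hQ₁, h₁⟩ := exists_mul_cubic
    1 (-((2 * α + 2 * n + 1) / 4)) ((2 * α + 2 * n + 1) * (2 * α + 6 * n + 3) / 32)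
      (-((2 * α + 2 * n + 1) * (α * (4 * n + 2) + 8 * n ^ 2 + 8 * n + 3) / 64))
    1 (-((2 * α + 2 * n - 1) / 4)) ((2 * α + 2 * n - 1) * (2 * α + 6 * n - 3) / 32)
      (-((2 * α + 2 * n - 1) * (α * (4 * n - 2) + 8 * n ^ 2 - 8 * n + 3) / 64))
  -- The second factor is the cubic part of the product in `h₁`; its tail `Q₁` re-enters multiplied
  -- by `expD`.
  obtain ⟨Q₂, hQ₂, h₂⟩ := exists_mul_cubic
    (n / 2) ((2 * α * n + 3 * n ^ 2) / 4)
      (3 * n * (2 * α + 2 * n + 1) * (2 * α + 2 * n - 1) / 64)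
      (-(n ^ 2 * (2 * α + 2 * n + 1) * (2 * α + 2 * n - 1) / 32))
    (1 * 1) (1 * (-((2 * α + 2 * n - 1) / 4)) + -((2 * α + 2 * n + 1) / 4) * 1)
      (1 * ((2 * α + 2 * n - 1) * (2 * α + 6 * n - 3) / 32) +
        -((2 * α + 2 * n + 1) / 4) * (-((2 * α + 2 * n - 1) / 4)) +
        (2 * α + 2 * n + 1) * (2 * α + 6 * n + 3) / 32 * 1)
      (1 * (-((2 * α + 2 * n - 1) * (α * (4 * n - 2) + 8 * n ^ 2 - 8 * n + 3) / 64)) +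
        -((2 * α + 2 * n + 1) / 4) * ((2 * α + 2 * n - 1) * (2 * α + 6 * n - 3) / 32) +
        (2 * α + 2 * n + 1) * (2 * α + 6 * n + 3) / 32 * (-((2 * α + 2 * n - 1) / 4)) +
        -((2 * α + 2 * n + 1) * (α * (4 * n + 2) + 8 * n ^ 2 + 8 * n + 3) / 64) * 1)
  obtain ⟨Q₃, hQ₃, h₃⟩ := exists_mul_cubic
    (-(n / 2)) 0 (n * (2 * α + 2 * n + 1) * (2 * α + 2 * n - 1) / 64)
      (-(n ^ 2 * (2 * α + 2 * n + 1) * (2 * α + 2 * n - 1) / 64))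
    (-(n / 2)) 0 (n * (2 * α + 2 * n + 1) * (2 * α + 2 * n - 1) / 64)
      (-(n ^ 2 * (2 * α + 2 * n + 1) * (2 * α + 2 * n - 1) / 64))
  have hD := continuous_expD α n
  refine ⟨fun s => Q₂ s + expD α n s * Q₁ s - s * Q₃ s -
    2 * (-(n / 2)) * (-(n ^ 2 * (2 * α + 2 * n + 1) * (2 * α + 2 * n - 1) / 64)),
    by fun_prop, fun s => ?_⟩
  have e₁ := h₁ s
  have e₂ := h₂ s
  have e₃ := h₃ s
  have hA : expA α n s * expA α (n - 1) s = _ := Eq.trans (by unfold expA; ring) e₁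
  rw [mul_assoc, hA]
  have hD' : expD α n s = n / 2 + (2 * α * n + 3 * n ^ 2) / 4 * s +
      3 * n * (2 * α + 2 * n + 1) * (2 * α + 2 * n - 1) / 64 * s ^ 2 +
      -(n ^ 2 * (2 * α + 2 * n + 1) * (2 * α + 2 * n - 1) / 32) * s ^ 3 := by unfold expD; ring
  rw [hD']
  unfold expB
  linear_combination (-s) * e₃ + e₂ - s ^ 4 * Q₁ s * hD'

/-! ### The bootstrap. -/

/-- Subtracting the approximate equation from the exact one gives (error) · G = E; a lower bound on
G is all that is needed to divide. -/
lemma isBigO_of_mul_eq {ι : Type*} {l : Filter ι} {f E G g : ι → ℝ}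
    (hG : ∀ᶠ t in l, 1 / 2 ≤ G t) (h : ∀ᶠ t in l, f t * G t = E t) (hE : E =O[l] g) :
    f =O[l] g := by
  refine IsBigO.trans (IsBigO.of_bound 2 ?_) hE
  filter_upwards [hG, h] with t h1 h2
  rw [← h2, norm_mul, Real.norm_of_nonneg (by linarith : 0 ≤ G t)]
  nlinarith [norm_nonneg (f t)]

section Bootstrap

variable {ι : Type*} {l : Filter ι} {α : ℝ} {s : ι → ℝ} {A D B : ℕ → ι → ℝ}

lemma isBigO_one_of_continuous (hs : Tendsto s l (nhds 0)) {Q : ℝ → ℝ} (hQ : Continuous Q) :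
    (fun t => Q (s t)) =O[l] (fun _ => (1 : ℝ)) :=
  ((hQ.tendsto 0).comp hs).isBigO_one ℝ

lemma isBigO_pow_of_le (hs : Tendsto s l (nhds 0)) {k m : ℕ} (h : k ≤ m) :
    (fun t => s t ^ m) =O[l] (fun t => s t ^ k) := by
  have h1 := (isBigO_refl (fun t => s t ^ k) l).mul
    (isBigO_one_of_continuous hs (continuous_pow (M := ℝ) (m - k)))
  simpa only [← pow_add, Nat.add_sub_cancel' h, mul_one] using h1

lemma isBigO_pow_mul (hs : Tendsto s l (nhds 0)) {k m : ℕ} (h : k ≤ m) {Q : ℝ → ℝ}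
    (hQ : Continuous Q) : (fun t => s t ^ m * Q (s t)) =O[l] (fun t => s t ^ k) := by
  simpa only [mul_one] using (isBigO_pow_of_le hs h).mul (isBigO_one_of_continuous hs hQ)

/-- One round of the bootstrap: the first equation of the scaled system. -/
lemma isBigO_A_step (hs : Tendsto s l (nhds 0))
    (H : ∀ᶠ t in l, IsScaledSystem α (s t) (fun n => A n t) (fun n => D n t) (fun n => B n t))
    {k : ℕ} (hk : k ≤ 3) (hB : ∀ n, (fun t => B n t - expB α n (s t)) =O[l] (fun t => s t ^ k))
    (n : ℕ) : (fun t => A n t - expA α n (s t)) =O[l] (fun t => s t ^ (k + 1)) := by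
  obtain ⟨Q, hQ, hres⟩ := exists_expA_eq α n
  have hsk : (fun t => s t * ((B n t - expB α n (s t)) +
      (B (n + 1) t - expB α ((n + 1 : ℕ) : ℝ) (s t)))) =O[l] (fun t => s t ^ (k + 1)) := by
    simpa only [pow_succ'] using (isBigO_refl s l).mul ((hB n).add (hB (n + 1)))
  have hcont : Continuous fun x => expA α n x + (2 * n + 1 + α) * x :=
    (continuous_expA α n).add (by fun_prop)
  have hev : ∀ᶠ t in l, 1 / 2 < expA α n (s t) + (2 * n + 1 + α) * s t := by
    refine ((hcont.tendsto 0).comp hs).eventually_const_lt ?_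
    norm_num [expA]
  -- The difference of the quadratics in A factors as (A - `expA`) · G. Since A > 0, G is bounded
  -- below before anything is known about the limit of A.
  refine isBigO_of_mul_eq (G := fun t => A n t + expA α n (s t) + (2 * n + 1 + α) * s t)
    (E := fun t => -(s t * ((B n t - expB α n (s t)) +
      (B (n + 1) t - expB α ((n + 1 : ℕ) : ℝ) (s t)))) - s t ^ 4 * Q (s t)) ?_ ?_
    (hsk.neg_left.sub (isBigO_pow_mul hs (by omega) hQ))
  · filter_upwards [hev, H] with t h1 h2
    linarith [h2.A_pos n]
  · filter_upwards [H] with t h2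
    have h3 := h2.A_eq n
    have h4 := hres (s t)
    push_cast
    linear_combination h3 - h4

lemma tendsto_A (hs : Tendsto s l (nhds 0)) {k n : ℕ}
    (hA : (fun t => A n t - expA α n (s t)) =O[l] (fun t => s t ^ (k + 1))) :
    Tendsto (A n) l (nhds 1) := by
  have h1 : Tendsto (fun t => A n t - expA α n (s t)) l (nhds 0) :=
    hA.trans_tendsto (by simpa using hs.pow (k + 1))
  have h2 : Tendsto (fun t => expA α n (s t)) l (nhds 1) := by
    have := ((continuous_expA α n).tendsto 0).comp hs
    rwa [show expA α n 0 = 1 by simp [expA]] at this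
  simpa using h1.add h2

/-- One round of the bootstrap: the second equation of the scaled system. -/
lemma isBigO_D_step (hs : Tendsto s l (nhds 0))
    (H : ∀ᶠ t in l, IsScaledSystem α (s t) (fun n => A n t) (fun n => D n t) (fun n => B n t))
    {k : ℕ} (hk : k ≤ 3) (hB : ∀ n, (fun t => B n t - expB α n (s t)) =O[l] (fun t => s t ^ k))
    (hA : ∀ n, (fun t => A n t - expA α n (s t)) =O[l] (fun t => s t ^ (k + 1)))
    (n : ℕ) : (fun t => D n t - expD α n (s t)) =O[l] (fun t => s t ^ (k + 1)) := by
  cases n with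
  | zero =>
    refine (isBigO_zero _ _).congr' ?_ EventuallyEq.rfl
    filter_upwards [H] with t h
    simp [h.D_zero, expD]
  | succ n =>
  obtain ⟨Q, hQ, hres⟩ := exists_expD_eq α ((n + 1 : ℕ) : ℝ)
  have hlim := (tendsto_A hs (hA (n + 1))).add (tendsto_A hs (hA n))
  have hsB := (isBigO_refl s l).mul (hB (n + 1))
  simp only [← pow_succ'] at hsB
  have hDA := (isBigO_one_of_continuous hs (continuous_expD α ((n + 1 : ℕ) : ℝ))).mul
    ((hA (n + 1)).add (hA n))
  simp only [one_mul] at hDA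
  refine isBigO_of_mul_eq (hlim.eventually_const_le (by norm_num)) ?_
    ((hDA.neg_left.sub (hsB.const_mul_left (2 * (n + 1) + α))).sub
      (isBigO_pow_mul hs (by omega : k + 1 ≤ 4) hQ))
  filter_upwards [H] with t h2
  have h3 := h2.D_eq n
  have h4 := hres (s t)
  push_cast at h4 ⊢
  rw [add_sub_cancel_right] at h4
  linear_combination h3 - h4

/-- One round of the bootstrap: the third equation of the scaled system. -/
lemma isBigO_B_step (hα : -1 < α) (hs : Tendsto s l (nhds 0)) (hs0 : ∀ᶠ t in l, 0 < s t)
    (H : ∀ᶠ t in l, IsScaledSystem α (s t) (fun n => A n t) (fun n => D n t) (fun n => B n t))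
    {k : ℕ} (hk : k ≤ 3)
    (hA : ∀ n, (fun t => A n t - expA α n (s t)) =O[l] (fun t => s t ^ (k + 1)))
    (hD : ∀ n, (fun t => D n t - expD α n (s t)) =O[l] (fun t => s t ^ (k + 1)))
    (n : ℕ) : (fun t => B n t - expB α n (s t)) =O[l] (fun t => s t ^ (k + 1)) := by
  cases n with
  | zero =>
    refine (isBigO_zero _ _).congr' ?_ EventuallyEq.rfl
    filter_upwards [H] with t h
    simp [h.B_zero, expB]
  | succ n =>
  obtain ⟨Q, hQ, hres⟩ := exists_expB_eq α ((n + 1 : ℕ) : ℝ)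
  have hA0 := (tendsto_A hs (hA n)).isBigO_one ℝ
  have hA1 := (tendsto_A hs (hA (n + 1))).isBigO_one ℝ
  have hD0 := isBigO_one_of_continuous hs (continuous_expD α ((n + 1 : ℕ) : ℝ))
  have hE1 := isBigO_one_of_continuous hs (continuous_expA α ((n + 1 : ℕ) : ℝ))
  -- The difference of the triple products D A_{n+1} A_n is split by replacing one factor at a time.
  have t1 := ((hD (n + 1)).mul hA1).mul hA0
  have t2 := (hD0.mul (hA (n + 1))).mul hA0
  have t3 := (hD0.mul hE1).mul (hA n)
  simp only [one_mul, mul_one] at t1 t2 t3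
  have hcont : Continuous fun x => 1 - x * expB α ((n + 1 : ℕ) : ℝ) x :=
    continuous_const.sub (continuous_id.mul (continuous_expB α _))
  have hev : ∀ᶠ t in l, 1 / 2 < 1 - s t * expB α ((n + 1 : ℕ) : ℝ) (s t) := by
    refine ((hcont.tendsto 0).comp hs).eventually_const_lt ?_
    norm_num
  refine isBigO_of_mul_eq
    (G := fun t => 1 - s t * (B (n + 1) t + expB α ((n + 1 : ℕ) : ℝ) (s t))) ?_ ?_
    (((t1.add t2).add t3).neg_left.sub (isBigO_pow_mul hs (by omega : k + 1 ≤ 4) hQ))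
  · filter_upwards [hev, H, hs0] with t h1 h2 h3
    -- As B < 0, the term -s B only increases G.
    nlinarith [h2.B_succ_neg hα n]
  · filter_upwards [H] with t h2
    have h3 := h2.B_eq n
    have h4 := hres (s t)
    push_cast at h4 ⊢
    rw [add_sub_cancel_right] at h4
    linear_combination h3 - h4

/-- The solutions of the scaled system have the expected expansions as `s → 0`. -/
theorem isBigO_scaledSystem (hα : -1 < α) (hs : Tendsto s l (nhds 0)) (hs0 : ∀ᶠ t in l, 0 < s t)
    (H : ∀ᶠ t in l, IsScaledSystem α (s t) (fun n => A n t) (fun n => D n t) (fun n => B n t))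
    (n : ℕ) : (fun t => A n t - expA α n (s t)) =O[l] (fun t => s t ^ 4) ∧
      (fun t => D n t - expD α n (s t)) =O[l] (fun t => s t ^ 4) := by
  -- Order 3 is enough for B: the last round for A and D gains one more power, matching the residual
  -- s⁴.
  have hB : ∀ k ≤ 3, ∀ n, (fun t => B n t - expB α n (s t)) =O[l] (fun t => s t ^ k) := by
    intro k
    induction k with
    | zero =>
      intro _ n
      obtain ⟨K, -, hK⟩ := exists_bound_scaledSystem hα n
      simp only [pow_zero]
      refine IsBigO.sub (IsBigO.of_bound K ?_)
        (isBigO_one_of_continuous hs (continuous_expB α n))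
      filter_upwards [H, hs0, hs.eventually_le_const one_pos] with t h1 h2 h3
      simpa using hK _ _ _ _ h2 h3 h1
    | succ k ih =>
      intro hk
      have hk' : k ≤ 3 := by omega
      have hA := isBigO_A_step hs H hk' (ih hk')
      exact isBigO_B_step hα hs hs0 H hk' hA (isBigO_D_step hs H hk' (ih hk') hA)
  have hA := isBigO_A_step hs H le_rfl (hB 3 le_rfl)
  exact ⟨hA n, isBigO_D_step hs H le_rfl (hB 3 le_rfl) hA n⟩

end Bootstrap

/-! ### Return to the recurrence coefficients. -/

/-- The three relations are multiplied by s², s² and -s³, and s² t = 1 removes t. -/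
lemma exists_isScaledSystem {α t : ℝ} (hα : -1 < α) (ht : 0 < t) : ∃ B : ℕ → ℝ,
    IsScaledSystem α (√t)⁻¹ (fun n => (√t)⁻¹ * (recA α t n - (2 * n + 1 + α)))
      (fun n => (√t)⁻¹ * recB α t n) B := by
  obtain ⟨b, hb0, hb⟩ := exists_laguerreFreud hα ht
  have hs : 0 < (√t)⁻¹ := inv_pos.2 (Real.sqrt_pos.2 ht)
  have hst : (√t)⁻¹ ^ 2 * t = 1 := by
    rw [inv_pow, Real.sq_sqrt ht.le, inv_mul_cancel₀ ht.ne']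
  refine ⟨fun n => (√t)⁻¹ * b n, ⟨by simp [hb0], by simp [recB], fun n => mul_pos hs (hb n).1,
    fun n => mul_pos hs (recB_succ_pos hα ht.le n), fun n => ?_, fun n => ?_, fun n => ?_⟩⟩
  · linear_combination (√t)⁻¹ ^ 2 * (hb n).2.1 + hst
  · have h := (hb n).2.2.1
    push_cast
    linear_combination (√t)⁻¹ ^ 2 * h + (n + 1) * hst
  · have h := (hb n).2.2.2
    push_cast
    linear_combination (-(√t)⁻¹ ^ 3) * h - (√t)⁻¹ * b (n + 1) * hst

end SingularLaguerre

end

theorem theorem5p1 (α : ℝ) (hα : -1 < α) (n : ℕ) :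
    (fun t : ℝ => SingularLaguerre.recA α t n -
        (√t + (2 * α + 3 * (2 * (n : ℝ) + 1)) / 4
          + (2 * α + 2 * (n : ℝ) + 1) * (2 * α + 6 * (n : ℝ) + 3) / (32 * √t)
          - (2 * α + 2 * (n : ℝ) + 1) * (α * (4 * (n : ℝ) + 2) + 8 * (n : ℝ) ^ 2 + 8 * (n : ℝ) + 3)
              / (64 * t)))
      =O[Filter.atTop] (fun t : ℝ => t ^ (-(3 / 2) : ℝ)) ∧
    (fun t : ℝ => SingularLaguerre.recB α t n -
        ((n : ℝ) * √t / 2 + (2 * α * (n : ℝ) + 3 * (n : ℝ) ^ 2) / 4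
          + 3 * (n : ℝ) * (2 * α + 2 * (n : ℝ) + 1) * (2 * α + 2 * (n : ℝ) - 1) / (64 * √t)
          - (n : ℝ) ^ 2 * (2 * α + 2 * (n : ℝ) + 1) * (2 * α + 2 * (n : ℝ) - 1) / (32 * t)))
      =O[Filter.atTop] (fun t : ℝ => t ^ (-(3 / 2) : ℝ)) := by
  have hs : Filter.Tendsto (fun t : ℝ => (√t)⁻¹) Filter.atTop (nhds 0) :=
    Real.tendsto_sqrt_atTop.inv_tendsto_atTop
  have hpos : ∀ᶠ t : ℝ in Filter.atTop, 0 < t := Filter.eventually_gt_atTop 0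
  have hs0 : ∀ᶠ t : ℝ in Filter.atTop, 0 < (√t)⁻¹ := by
    filter_upwards [hpos] with t ht using inv_pos.2 (Real.sqrt_pos.2 ht)
  choose B hB using fun (t : ℝ) (ht : 0 < t) => SingularLaguerre.exists_isScaledSystem hα ht
  have H : ∀ᶠ t : ℝ in Filter.atTop, SingularLaguerre.IsScaledSystem α (√t)⁻¹
      (fun n => (√t)⁻¹ * (SingularLaguerre.recA α t n - (2 * n + 1 + α))) (fun n => (√t)⁻¹ * SingularLaguerre.recB α t n)
      (fun n => if ht : 0 < t then B t ht n else 0) := by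
    filter_upwards [hpos] with t ht
    simpa only [dif_pos ht] using hB t ht
  obtain ⟨h1, h2⟩ := SingularLaguerre.isBigO_scaledSystem hα hs hs0
    (A := fun n t => (√t)⁻¹ * (SingularLaguerre.recA α t n - (2 * n + 1 + α)))
    (D := fun n t => (√t)⁻¹ * SingularLaguerre.recB α t n)
    (B := fun n t => if ht : 0 < t then B t ht n else 0) H n
  have hr : ∀ᶠ t : ℝ in Filter.atTop, √t * (√t)⁻¹ ^ 4 = t ^ (-(3 / 2) : ℝ) := by
    filter_upwards [hpos] with t ht
    have h0 := (Real.sqrt_pos.2 ht).ne'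
    rw [Real.rpow_neg ht.le, show (3 / 2 : ℝ) = (1 / 2 : ℝ) * (3 : ℕ) by norm_num,
      Real.rpow_mul ht.le, ← Real.sqrt_eq_rpow, Real.rpow_natCast]
    field_simp
  have hsq : ∀ t : ℝ, 0 < t → t = √t ^ 2 := fun t ht => (Real.sq_sqrt ht.le).symm
  constructor
  -- Undoing the scaling adds 2n+1+α to the coefficient -(2α+2n+1)/4 of s in `expA`, which gives the
  -- constant term (2α+3(2n+1))/4.
  · refine ((Asymptotics.isBigO_refl Real.sqrt Filter.atTop).mul h1).congr' ?_ hr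
    filter_upwards [hpos] with t ht
    have h0 := (Real.sqrt_pos.2 ht).ne'
    have h3 : 64 * t = 64 * √t ^ 2 := by rw [← hsq t ht]
    rw [h3, SingularLaguerre.expA]
    field_simp
    ring
  · refine ((Asymptotics.isBigO_refl Real.sqrt Filter.atTop).mul h2).congr' ?_ hr
    filter_upwards [hpos] with t ht
    have h0 := (Real.sqrt_pos.2 ht).ne'
    have h3 : 32 * t = 32 * √t ^ 2 := by rw [← hsq t ht]
    rw [h3, SingularLaguerre.expD]
    field_simp
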